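/- An mm-space is a complete separable metric space $X$ with a Borel probability measure $\mu_X$ such that $\operatorname{supp}\mu_X=X$; mm-spaces are considered up to measure-preserving isometry. For mm-spaces write $Y\prec X$ if there is a $1$-Lipschitz map $f:X\to Y$ with $f_*\mu_X=\mu_Y$. The box distance $\square(X,Y)$ is the infimum of all $\varepsilon\ge 0$ for which there are Borel maps $\varphi:[0,1)\to X$, $\psi:[0,1)\to Y$ pushing the Lebesgue measure $\mathcal L^1$ forward to $\mu_X$, $\mu_Y$, respectively, and a Borel set $I_0\subset[0,1)$ with $\mathcal L^1(I_0)\ge 1-\varepsilon$ and $|d_X(\varphi(s),\varphi(t))-d_Y(\psi(s),\psi(t))|\le\varepsilon$ for all $s,t\in I_0$. A pyramid is a nonempty $\square$-closed family $\mathcal P$ of mm-spaces such that $X\in\mathcal P$ and $Y\prec X$ imply $Y\in\mathcal P$, and such that for all $X,X'\in\mathcal P$ there is $Y\in\mathcal P$ with $X\prec Y$ and $X'\prec Y$. Pyramids $\mathcal P_n$ converge weakly to a pyramid $\mathcal P$ if, with $\square(X,\mathcal P_n):=\inf_{Y\in\mathcal P_n}\square(X,Y)$, $\lim_{n\to\infty}\square(X,\mathcal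 P_n)=0$ for every mm-space $X\in\mathcal P$ and $\liminf_{n\to\infty}\square(X,\mathcal P_n)>0$ for every mm-space $X\notin\mathcal P$. For an integer $N\ge 1$ and $\kappa_0,\dots,\kappa_N>0$ let $\operatorname{Sep}(X;\kappa_0,\dots,\kappa_N)$ be the supremum of $\min_{i\ne j}d_X(A_i,A_j)$, where $d_X(A,B):=\inf_{x\in A,\,y\in B}d_X(x,y)$, over all Borel sets $A_0,\dots,A_N\subset X$ with $\mu_X(A_i)\ge\kappa_i$ for all $i$ (and $0$ if there are no such sets), and for a pyramid $\mathcal P$ let $$\operatorname{Sep}(\mathcal P;\kappa_0,\dots,\kappa_N):=\lim_{\delta\to0+}\ \sup_{X\in\mathcal P}\operatorname{Sep}(X;\kappa_0-\delta,\dots,\kappa_N-\delta)\in[0,+\infty].$$ A sequence of pyramids $\{\mathcal P_n\}$ is an $N$-Lévy family if $\lim_{n\to\infty}\operatorname{Sep}(\mathcal P_n;\kappa_0,\dots,\kappa_N)=0$ for all $\kappa_0,\dots,\kappa_N>0$ with $\sum_{i=0}^N\kappa_i<1$. An extended mm-space is defined like an mm-space, but with a metric taking values in $[0,+\infty]$;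 its associated family $\mathcal P_X$ consists of all mm-spaces $Y$ for which there is a $1$-Lipschitz map $f:X\to Y$ with $f_*\mu_X=\mu_Y$. **Theorem.** Let $\{\mathcal P_n\}_{n=1}^\infty$ be a sequence of pyramids converging weakly to a pyramid $\mathcal P$, and let $N\ge1$ be an integer. Then the following are equivalent: 1. $\{\mathcal P_n\}$ is an $N$-Lévy family. 2. There exists a finite extended mm-space $X$ with $\#X\le N$ such that $\mathcal P=\mathcal P_X$. -/

import Mathlib

open MeasureTheory Filter Set
open scoped Topology ENNReal NNReal

/-- An mm-space: a complete separable metric space with a Borel probability measure of full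
support.  (Every complete separable metric space has at most continuum many points, so carriers
in `Type` represent all mm-isomorphism classes.) -/
structure MMSpace : Type 1 where
  carrier : Type
  [metric : MetricSpace carrier]
  [complete : CompleteSpace carrier]
  [separable : TopologicalSpace.SeparableSpace carrier]
  [meas : MeasurableSpace carrier]
  [borel : BorelSpace carrier]
  μ : Measure carrier
  [prob : IsProbabilityMeasure μ]
  [fullSupport : μ.IsOpenPosMeasure]

/-- An extended mm-space: as an mm-space, but the metric takes values in `[0, ∞]`. -/
structure ExtMMSpace : Type 1 where
  carrier : Type
  [emetric : EMetricSpace carrier]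
  [complete : CompleteSpace carrier]
  [separable : TopologicalSpace.SeparableSpace carrier]
  [meas : MeasurableSpace carrier]
  [borel : BorelSpace carrier]
  μ : Measure carrier
  [prob : IsProbabilityMeasure μ]
  [fullSupport : μ.IsOpenPosMeasure]

attribute [instance] MMSpace.metric MMSpace.complete MMSpace.separable MMSpace.meas
  MMSpace.borel MMSpace.prob MMSpace.fullSupport
attribute [instance] ExtMMSpace.emetric ExtMMSpace.complete ExtMMSpace.separable
  ExtMMSpace.meas ExtMMSpace.borel ExtMMSpace.prob ExtMMSpace.fullSupport

/-- There is a `1`-Lipschitz map pushing `μ` forward to `ν`. -/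
def LipDominates {α β : Type} [EMetricSpace α] [MeasurableSpace α] [EMetricSpace β]
    [MeasurableSpace β] (μ : Measure α) (ν : Measure β) : Prop :=
  ∃ f : α → β, LipschitzWith 1 f ∧ Measure.map f μ = ν

namespace MMSpace

/-- The Lipschitz order `Y ≺ X` on mm-spaces. -/
def Prec (Y X : MMSpace) : Prop := LipDominates X.μ Y.μ

/-- `X` and `Y` are mm-isomorphic (both measures have full support). -/
def Iso (X Y : MMSpace) : Prop :=
  ∃ f : X.carrier → Y.carrier, Isometry f ∧ Measure.map f X.μ = Y.μ

/-- The interval `[0, 1)`. -/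
abbrev ParamInterval : Type := Set.Ico (0 : ℝ) 1

/-- Lebesgue measure on `[0, 1)`. -/
noncomputable def leb : Measure ParamInterval := Measure.comap Subtype.val volume

/-- A parameter of `X`: a Borel map `[0, 1) → X` pushing Lebesgue measure forward to `μ_X`. -/
def IsParameter (X : MMSpace) (φ : ParamInterval → X.carrier) : Prop :=
  Measurable φ ∧ Measure.map φ leb = X.μ

/-- The box distance between two mm-spaces (it is at most `1`). -/
noncomputable def box (X Y : MMSpace) : ℝ≥0∞ :=
  ⨅ (ε : ℝ≥0) (_ : ∃ (φ : ParamInterval → X.carrier) (ψ : ParamInterval → Y.carrier)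
      (I₀ : Set ParamInterval), X.IsParameter φ ∧ Y.IsParameter ψ ∧ MeasurableSet I₀ ∧
      (∀ s ∈ I₀, ∀ t ∈ I₀, |dist (φ s) (φ t) - dist (ψ s) (ψ t)| ≤ ε) ∧
      1 - (ε : ℝ≥0∞) ≤ leb I₀), (ε : ℝ≥0∞)

/-- The box distance `□(X, P) = inf_{Y ∈ P} □(X, Y)` from `X` to a family of mm-spaces. -/
noncomputable def boxInf (X : MMSpace) (P : Set MMSpace) : ℝ≥0∞ := ⨅ Y ∈ P, X.box Y

/-- The separation distance `Sep(X; κ₀, …, κ_N)`, for `N ≥ 1` and `κ_i > 0`. The supremum is `0`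
if no admissible sets `A₀, …, A_N` exist. -/
noncomputable def sep (X : MMSpace) {N : ℕ} (κ : Fin (N + 1) → ℝ) : ℝ≥0∞ :=
  ⨆ (A : Fin (N + 1) → Set X.carrier)
    (_ : ∀ i, MeasurableSet (A i) ∧ ENNReal.ofReal (κ i) ≤ X.μ (A i)),
    ⨅ (i : Fin (N + 1)) (j : Fin (N + 1)) (_ : i ≠ j), ⨅ x ∈ A i, ⨅ y ∈ A j, edist x y

end MMSpace

/-- A pyramid. Families of mm-isomorphism classes are represented by families of mm-spaces; by
`IsPyramid.mem_iff_of_iso` a pyramid is automatically invariant under mm-isomorphism. -/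
structure IsPyramid (P : Set MMSpace) : Prop where
  mem_of_prec : ∀ X ∈ P, ∀ Y : MMSpace, Y.Prec X → Y ∈ P
  directed : ∀ X ∈ P, ∀ X' ∈ P, ∃ Y ∈ P, X.Prec Y ∧ X'.Prec Y
  nonempty : P.Nonempty
  box_closed : ∀ X : MMSpace, (∀ ε > 0, ∃ Y ∈ P, X.box Y < ε) → X ∈ P

theorem IsPyramid.mem_iff_of_iso {P : Set MMSpace} (hP : IsPyramid P) {X Y : MMSpace}
    (h : X.Iso Y) : X ∈ P ↔ Y ∈ P := by
  obtain ⟨f, hf, hm⟩ := h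
  have hfm : Measurable f := hf.continuous.measurable
  have hcl : IsClosed (range f) := hf.isClosedEmbedding.isClosed_range
  have hsurj : Function.Surjective f := by
    rw [← range_eq_univ, ← compl_empty_iff]
    refine (hcl.isOpen_compl.measure_eq_zero_iff Y.μ).1 ?_
    rw [← hm, Measure.map_apply hfm hcl.isOpen_compl.measurableSet]
    have : f ⁻¹' (range f)ᶜ = ∅ := by ext x; simp
    rw [this, measure_empty]
  have hinv := Function.rightInverse_surjInv hsurj
  have hg : Isometry (Function.surjInv hsurj) := hf.right_inv hinv
  refine ⟨fun hX => hP.mem_of_prec X hX Y ⟨f, hf.lipschitz, hm⟩,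
    fun hY => hP.mem_of_prec Y hY X ⟨_, hg.lipschitz, ?_⟩⟩
  rw [← hm, Measure.map_map hg.continuous.measurable hfm]
  have : Function.surjInv hsurj ∘ f = id := by
    funext x
    exact Function.leftInverse_surjInv ⟨hf.injective, hsurj⟩ x
  rw [this, Measure.map_id]

/-- Weak convergence of pyramids. -/
def WeakConverges (P : ℕ → Set MMSpace) (Q : Set MMSpace) : Prop :=
  (∀ X ∈ Q, Tendsto (fun n => X.boxInf (P n)) atTop (𝓝 0)) ∧
  (∀ X ∉ Q, 0 < liminf (fun n => X.boxInf (P n)) atTop)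

/-- The separation distance of a pyramid,
`lim_{δ → 0+} sup_{X ∈ P} Sep(X; κ₀ - δ, …, κ_N - δ)`; the limit always exists, see
`tendsto_pyramidSep`. -/
noncomputable def pyramidSep (P : Set MMSpace) {N : ℕ} (κ : Fin (N + 1) → ℝ) : ℝ≥0∞ :=
  limUnder (𝓝[>] (0 : ℝ)) (fun δ => ⨆ X ∈ P, X.sep (fun i => κ i - δ))

theorem tendsto_pyramidSep (P : Set MMSpace) {N : ℕ} (κ : Fin (N + 1) → ℝ) :
    Tendsto (fun δ : ℝ => ⨆ X ∈ P, X.sep (fun i => κ i - δ)) (𝓝[>] 0)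
      (𝓝 (pyramidSep P κ)) := by
  have hmono : Monotone (fun δ : ℝ => ⨆ X ∈ P, X.sep (fun i => κ i - δ)) := by
    intro a b hab
    refine iSup₂_mono fun X _ => iSup_mono fun A => iSup_mono' fun hA => ⟨fun i => ?_, le_rfl⟩
    exact ⟨(hA i).1, (ENNReal.ofReal_le_ofReal (by linarith)).trans (hA i).2⟩
  exact tendsto_nhds_limUnder ⟨_, hmono.tendsto_nhdsGT 0⟩

/-- `N`-Lévy families of pyramids. -/
def IsNLevy (N : ℕ) (P : ℕ → Set MMSpace) : Prop :=
  ∀ κ : Fin (N + 1) → ℝ, (∀ i, 0 < κ i) → ∑ i, κ i < 1 →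
    Tendsto (fun n => pyramidSep (P n) κ) atTop (𝓝 0)

/-- The pyramid `P_X` of all mm-spaces dominated by the extended mm-space `X`. -/
def ExtMMSpace.pyramid (X : ExtMMSpace) : Set MMSpace := {Y | LipDominates X.μ Y.μ}

/-!
The proof splits into two independent parts, which meet in the condition that every space of the
weak limit `Q` has at most `N` points.

*This condition is equivalent to the `N`-Lévy property.* If `Y ∈ Q` has `N + 1` distinct points, small
balls around them are sets of positive measure at positive distance; since `□(Y, P n) → 0`, they can
be transported to spaces in `P n` (`not_isNLevy_of_injective`). Conversely, if the separation
distances do not tend to `0`, there are infinitely often spaces in `P n` with `N + 1` sets of mass at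
least `δ` that are more than `r` apart. Truncated distances to these sets give `1`-Lipschitz maps to
the cube `[0, r]^(N+1)` which collapse the sets to `N + 1` fixed vertices. By compactness the image
measures have a weak limit along an ultrafilter, and it has mass at least `δ` at each of the vertices.
Weak convergence implies convergence in the box distance (`MMSpace.eventually_box_ofMeasure_le`), so
the support of the limit is a space in `Q` with more than `N` points
(`exists_injective_of_not_isNLevy`).

*A pyramid `Q` satisfies the condition if and only if it is `P_X` for some `X` with at most `N` points.*
One direction holds because `1`-Lipschitz images of `X` with full support have no more points than
`X`. For the other one (`IsPyramid.exists_eq_pyramid`), a space `Y₀ ∈ Q` with the maximal number of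
points is compared with the directed family of the spaces `Z ∈ Q` above it: each of them is `Y₀` with a
larger metric `ρ_Z`. The limit `ρ` of the `ρ_Z` along an ultrafilter may take the value `∞`. Each
`Y ∈ Q` is dominated by almost all `Z`, through finitely many possible maps `Y₀ → Y`, one of which works
for almost all `Z` and hence for `ρ`. Conversely, if `(Y₀, ρ)` dominates `Y`, then almost all `Z`
dominate the scaled copies `c Y` with `c < 1`, and `Y ∈ Q` since `Q` is closed.
-/

/-! ### Couplings and the box distance -/

namespace MMSpace

/-- The inclusion `[0, 1) → [0, 1]` carries `leb` to Lebesgue measure. -/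
theorem map_inclusion_leb :
    Measure.map (Set.inclusion Ico_subset_Icc_self : ParamInterval → unitInterval) leb
      = volume := by
  have hi : Measurable (Set.inclusion Ico_subset_Icc_self : ParamInterval → unitInterval) :=
    measurable_inclusion _
  ext s hs
  rw [Measure.map_apply hi hs, leb, (MeasurableEmbedding.subtype_coe measurableSet_Ico).comap_apply,
    Measure.Subtype.volume_def,
    (MeasurableEmbedding.subtype_coe measurableSet_Icc).comap_apply]
  have h : (Subtype.val '' (Set.inclusion Ico_subset_Icc_self ⁻¹' s) : Set ℝ)
      = (Subtype.val '' s) \ {1} := by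
    ext x
    simp only [mem_image, mem_preimage, Subtype.exists, Set.mem_sdiff, mem_singleton_iff]
    constructor
    · rintro ⟨a, ha, has, rfl⟩
      exact ⟨⟨a, Ico_subset_Icc_self ha, has, rfl⟩, ha.2.ne⟩
    · rintro ⟨⟨a, ha, has, rfl⟩, hne⟩
      exact ⟨a, ⟨ha.1, lt_of_le_of_ne ha.2 hne⟩, has, rfl⟩
  rw [h]
  exact measure_sdiff_null (measure_singleton _)

/-- Every Borel probability measure on a standard Borel space is an image of `leb`. -/
theorem exists_map_leb_eq {α : Type*} [MeasurableSpace α] [StandardBorelSpace α] (μ : Measure α)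
    [IsProbabilityMeasure μ] : ∃ φ : ParamInterval → α, Measurable φ ∧ Measure.map φ leb = μ := by
  have : Nonempty α := μ.nonempty_of_neZero
  obtain ⟨f, hf, hfμ⟩ := Measure.exists_measurable_map_eq μ
  refine ⟨f ∘ Set.inclusion Ico_subset_Icc_self, hf.comp (measurable_inclusion _), ?_⟩
  rw [← Measure.map_map hf (measurable_inclusion _), map_inclusion_leb, hfμ]

/-- Couplings bound the box distance: it suffices to have a coupling that gives mass at least
`1 - ε` to a set of pairs on which the metrics differ by at most `ε`. -/
theorem box_le_of_coupling {X Y : MMSpace} (π : Measure (X.carrier × Y.carrier))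
    (hfst : π.map Prod.fst = X.μ) (hsnd : π.map Prod.snd = Y.μ) {S : Set (X.carrier × Y.carrier)}
    (hS : MeasurableSet S) {ε : ℝ≥0} (hπ : 1 - (ε : ℝ≥0∞) ≤ π S)
    (hdist : ∀ p ∈ S, ∀ q ∈ S, |dist p.1 q.1 - dist p.2 q.2| ≤ ε) : X.box Y ≤ ε := by
  have : IsProbabilityMeasure π := by
    have h := X.prob
    rw [← hfst] at h
    exact Measure.isProbabilityMeasure_of_map Prod.fst
  obtain ⟨φ, hφ, rfl⟩ := exists_map_leb_eq π
  rw [Measure.map_map measurable_fst hφ] at hfst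
  rw [Measure.map_map measurable_snd hφ] at hsnd
  rw [Measure.map_apply hφ hS] at hπ
  exact iInf₂_le ε ⟨_, _, φ ⁻¹' S, ⟨measurable_fst.comp hφ, hfst⟩, ⟨measurable_snd.comp hφ, hsnd⟩,
    hφ hS, fun s hs t ht => hdist _ hs _ ht, hπ⟩

end MMSpace

theorem inv_mul_self_smul_measure {α : Type*} [MeasurableSpace α] (μ : Measure α)
    [IsFiniteMeasure μ] : ((μ univ)⁻¹ * μ univ) • μ = μ := by
  rcases eq_or_ne (μ univ) 0 with h | h
  · rw [Measure.measure_univ_eq_zero.1 h, smul_zero]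
  · rw [ENNReal.inv_mul_cancel h (measure_ne_top _ _), one_smul]

/-- Two probability measures can be coupled so that, for given disjoint families of cells `A i` and
`B i`, corresponding cells are matched up to the smaller of the two masses. -/
theorem exists_coupling {α β ι : Type*} [MeasurableSpace α] [MeasurableSpace β] [Countable ι]
    (μ : Measure α) (ν : Measure β) [IsProbabilityMeasure μ] [IsProbabilityMeasure ν]
    {A : ι → Set α} {B : ι → Set β} (hA : ∀ i, MeasurableSet (A i)) (hB : ∀ i, MeasurableSet (B i))
    (hAd : Pairwise (Function.onFun Disjoint A)) (hBd : Pairwise (Function.onFun Disjoint B)) :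
    ∃ π : Measure (α × β), π.map Prod.fst = μ ∧ π.map Prod.snd = ν ∧
      ∑' i, min (μ (A i)) (ν (B i)) ≤ π (⋃ i, A i ×ˢ B i) := by
  -- the factor that gives the product of the restrictions to `A i` and `B i` the mass
  -- `min (μ (A i)) (ν (B i))`
  set c : ι → ℝ≥0∞ := fun i => min (μ (A i)) (ν (B i)) * (μ (A i))⁻¹ * (ν (B i))⁻¹ with hc
  have hcA : ∀ i, c i * μ (A i) ≤ 1 := fun i => by
    calc c i * μ (A i)
        = (μ (A i))⁻¹ * μ (A i) * (min (μ (A i)) (ν (B i)) * (ν (B i))⁻¹) := by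
          simp only [hc]; ring
      _ ≤ 1 * (ν (B i) * (ν (B i))⁻¹) := by
          gcongr
          · exact ENNReal.inv_mul_le_one _
          · exact min_le_right _ _
      _ ≤ 1 := by rw [one_mul]; exact ENNReal.mul_inv_le_one _
  have hcB : ∀ i, c i * ν (B i) ≤ 1 := fun i => by
    calc c i * ν (B i)
        = (ν (B i))⁻¹ * ν (B i) * (min (μ (A i)) (ν (B i)) * (μ (A i))⁻¹) := by
          simp only [hc]; ring
      _ ≤ 1 * (μ (A i) * (μ (A i))⁻¹) := by
          gcongr
          · exact ENNReal.inv_mul_le_one _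
          · exact min_le_left _ _
      _ ≤ 1 := by rw [one_mul]; exact ENNReal.mul_inv_le_one _
  -- the matched part of the coupling
  set π₁ := Measure.sum (fun i => c i • (μ.restrict (A i)).prod (ν.restrict (B i))) with hπ₁
  have hfst : π₁.map Prod.fst ≤ μ := by
    calc π₁.map Prod.fst ≤ Measure.sum (fun i => μ.restrict (A i)) := by
          rw [hπ₁, Measure.map_sum measurable_fst.aemeasurable]
          refine Measure.le_iff.2 fun s hs => ?_
          rw [Measure.sum_apply _ hs, Measure.sum_apply _ hs]
          refine ENNReal.tsum_le_tsum fun i => ?_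
          rw [Measure.map_smul, Measure.map_fst_prod, Measure.restrict_apply_univ, smul_smul,
            Measure.smul_apply, smul_eq_mul]
          exact mul_le_of_le_one_left' (hcB i)
      _ = μ.restrict (⋃ i, A i) := (Measure.restrict_iUnion hAd hA).symm
      _ ≤ μ := Measure.restrict_le_self
  have hsnd : π₁.map Prod.snd ≤ ν := by
    calc π₁.map Prod.snd ≤ Measure.sum (fun i => ν.restrict (B i)) := by
          rw [hπ₁, Measure.map_sum measurable_snd.aemeasurable]
          refine Measure.le_iff.2 fun s hs => ?_
          rw [Measure.sum_apply _ hs, Measure.sum_apply _ hs]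
          refine ENNReal.tsum_le_tsum fun i => ?_
          rw [Measure.map_smul, Measure.map_snd_prod, Measure.restrict_apply_univ, smul_smul,
            Measure.smul_apply, smul_eq_mul]
          exact mul_le_of_le_one_left' (hcA i)
      _ = ν.restrict (⋃ i, B i) := (Measure.restrict_iUnion hBd hB).symm
      _ ≤ ν := Measure.restrict_le_self
  have hmass : ∑' i, min (μ (A i)) (ν (B i)) ≤ π₁ (⋃ i, A i ×ˢ B i) := by
    rw [hπ₁, Measure.sum_apply _ (MeasurableSet.iUnion fun i => (hA i).prod (hB i))]
    refine ENNReal.tsum_le_tsum fun i => ?_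
    refine le_trans ?_ (measure_mono (subset_iUnion _ i))
    rw [Measure.smul_apply, Measure.prod_prod, Measure.restrict_apply_self,
      Measure.restrict_apply_self, smul_eq_mul]
    rcases eq_or_ne (μ (A i)) 0 with h | h
    · simp [h]
    rcases eq_or_ne (ν (B i)) 0 with h' | h'
    · simp [h']
    have e : c i * (μ (A i) * ν (B i)) = min (μ (A i)) (ν (B i)) *
        ((μ (A i))⁻¹ * μ (A i)) * ((ν (B i))⁻¹ * ν (B i)) := by
      simp only [hc]; ring
    rw [e, ENNReal.inv_mul_cancel h (measure_ne_top _ _),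
      ENNReal.inv_mul_cancel h' (measure_ne_top _ _), mul_one, mul_one]
  -- the rest of the masses is coupled independently
  have hπu : (π₁.map Prod.fst) univ = (π₁.map Prod.snd) univ := by
    rw [Measure.map_apply measurable_fst MeasurableSet.univ,
      Measure.map_apply measurable_snd MeasurableSet.univ]
    rfl
  have : IsFiniteMeasure (π₁.map Prod.fst) := isFiniteMeasure_of_le _ hfst
  have : IsFiniteMeasure (π₁.map Prod.snd) := isFiniteMeasure_of_le _ hsnd
  set μ₂ := μ - π₁.map Prod.fst with hμ₂
  set ν₂ := ν - π₁.map Prod.snd with hν₂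
  have hμs : μ₂ + π₁.map Prod.fst = μ := Measure.sub_add_cancel_of_le hfst
  have hνs : ν₂ + π₁.map Prod.snd = ν := Measure.sub_add_cancel_of_le hsnd
  have : IsFiniteMeasure μ₂ := isFiniteMeasure_of_le μ Measure.sub_le
  have : IsFiniteMeasure ν₂ := isFiniteMeasure_of_le ν Measure.sub_le
  have hr : μ₂ univ = ν₂ univ := by
    have h1 : μ₂ univ + (π₁.map Prod.fst) univ = 1 := by
      rw [← Measure.add_apply, hμs, measure_univ]
    have h2 : ν₂ univ + (π₁.map Prod.snd) univ = 1 := by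
      rw [← Measure.add_apply, hνs, measure_univ]
    rw [← hπu, ← h1] at h2
    exact ((ENNReal.add_left_inj (measure_ne_top _ _)).1 h2).symm
  refine ⟨(μ₂ univ)⁻¹ • μ₂.prod ν₂ + π₁, ?_, ?_, ?_⟩
  · rw [Measure.map_add _ _ measurable_fst, Measure.map_smul, Measure.map_fst_prod, smul_smul, ← hr,
      inv_mul_self_smul_measure μ₂, hμs]
  · rw [Measure.map_add _ _ measurable_snd, Measure.map_smul, Measure.map_snd_prod, smul_smul, hr,
      inv_mul_self_smul_measure ν₂, hνs]
  · exact hmass.trans (by rw [Measure.add_apply]; exact le_add_self)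

/-! ### Mm-spaces of measures and weak convergence -/

namespace MMSpace

/-- A bound for the box distance by cells: if `X` and `Y` are cut into corresponding cells such that
choosing points in corresponding cells changes distances by at most `ε`, and corresponding cells have
masses in common that add up to at least `1 - ε`, then `□(X, Y) ≤ ε`. -/
theorem box_le_of_cells {X Y : MMSpace} {ι : Type*} [Countable ι] {A : ι → Set X.carrier}
    {B : ι → Set Y.carrier} (hA : ∀ i, MeasurableSet (A i)) (hB : ∀ i, MeasurableSet (B i))
    (hAd : Pairwise (Function.onFun Disjoint A)) (hBd : Pairwise (Function.onFun Disjoint B))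
    {ε : ℝ≥0} (hdist : ∀ i j, ∀ x ∈ A i, ∀ y ∈ B i, ∀ x' ∈ A j, ∀ y' ∈ B j,
      |dist x x' - dist y y'| ≤ ε)
    (hmass : 1 - (ε : ℝ≥0∞) ≤ ∑' i, min (X.μ (A i)) (Y.μ (B i))) : X.box Y ≤ ε := by
  obtain ⟨π, h1, h2, h3⟩ := exists_coupling X.μ Y.μ hA hB hAd hBd
  refine box_le_of_coupling π h1 h2 (MeasurableSet.iUnion fun i => (hA i).prod (hB i))
    (hmass.trans h3) ?_
  intro p hp q hq
  obtain ⟨i, hi⟩ := mem_iUnion.1 hp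
  obtain ⟨j, hj⟩ := mem_iUnion.1 hq
  exact hdist i j _ hi.1 _ hi.2 _ hj.1 _ hj.2

section OfMeasure

variable {α : Type} [MetricSpace α] [CompleteSpace α] [SecondCountableTopology α]
  [MeasurableSpace α] [BorelSpace α]

/-- The mm-space carried by the support of a Borel probability measure on a complete separable
metric space. -/
noncomputable def ofMeasure (ν : Measure α) [IsProbabilityMeasure ν] : MMSpace :=
  have hcl : IsClosed ν.support := Measure.isClosed_support
  have hres : ν.restrict ν.support = ν := Measure.restrict_eq_self_of_ae_mem Measure.support_mem_ae
  { carrier := ν.support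
    complete := hcl.completeSpace_coe
    μ := ν.comap Subtype.val
    prob := ⟨by
      rw [(MeasurableEmbedding.subtype_coe hcl.measurableSet).comap_apply, image_univ,
        Subtype.range_coe, prob_compl_eq_zero_iff hcl.measurableSet |>.1
          Measure.measure_compl_support]⟩
    fullSupport := ⟨fun U hU ⟨x, hx⟩ => by
      obtain ⟨V, hV, rfl⟩ := isOpen_induced_iff.1 hU
      rw [(MeasurableEmbedding.subtype_coe hcl.measurableSet).comap_apply,
        Subtype.image_preimage_coe, inter_comm,
        ← Measure.restrict_apply' hcl.measurableSet, hres]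
      exact ((Measure.mem_support_iff_forall x.1).1 x.2 V (hV.mem_nhds hx)).ne'⟩ }

/-- The inclusion of the mm-space `ofMeasure ν` into the ambient space. -/
def ofMeasureVal (ν : Measure α) [IsProbabilityMeasure ν] : (ofMeasure ν).carrier → α :=
  fun x => x.1

theorem isometry_ofMeasureVal (ν : Measure α) [IsProbabilityMeasure ν] :
    Isometry (ofMeasureVal ν) := isometry_subtype_coe (s := ν.support)

theorem measurable_ofMeasureVal (ν : Measure α) [IsProbabilityMeasure ν] :
    Measurable (ofMeasureVal ν) := (isometry_ofMeasureVal ν).continuous.measurable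

theorem ofMeasure_μ_preimage (ν : Measure α) [IsProbabilityMeasure ν] (s : Set α) :
    (ofMeasure ν).μ (ofMeasureVal ν ⁻¹' s) = ν s := by
  have hcl : IsClosed ν.support := Measure.isClosed_support
  have hres : ν.restrict ν.support = ν := Measure.restrict_eq_self_of_ae_mem Measure.support_mem_ae
  have h : (ν.comap (Subtype.val : ν.support → α)) (Subtype.val ⁻¹' s) = ν s := by
    rw [(MeasurableEmbedding.subtype_coe hcl.measurableSet).comap_apply,
      Subtype.image_preimage_coe, inter_comm, ← Measure.restrict_apply' hcl.measurableSet, hres]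
  exact h

/-- The image measure of a `1`-Lipschitz map defines a dominated mm-space. -/
theorem ofMeasure_map_prec (X : MMSpace) {f : X.carrier → α} (hf : LipschitzWith 1 f)
    [IsProbabilityMeasure (X.μ.map f)] : (ofMeasure (X.μ.map f)).Prec X := by
  have hfm : Measurable f := hf.continuous.measurable
  have hmem : ∀ x, f x ∈ (X.μ.map f).support := fun x => by
    refine (Measure.mem_support_iff_forall _).2 fun U hU => ?_
    refine lt_of_lt_of_le ?_ (Measure.le_map_apply hfm.aemeasurable U)
    exact Measure.measure_pos_of_mem_nhds _ (hf.continuous.continuousAt hU)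
  let g : X.carrier → (ofMeasure (X.μ.map f)).carrier := fun x => ⟨f x, hmem x⟩
  have hg : LipschitzWith 1 g := fun x y => hf x y
  refine ⟨g, hg, ?_⟩
  ext s hs
  rw [Measure.map_apply hg.continuous.measurable hs]
  obtain ⟨t, ht, rfl⟩ : ∃ t, MeasurableSet t ∧ ofMeasureVal (X.μ.map f) ⁻¹' t = s := hs
  rw [ofMeasure_μ_preimage, Measure.map_apply hfm ht]
  rfl

/-- Every Borel probability measure admits a countable Borel partition into small sets with null
boundary. -/
theorem exists_partition_null_frontier {α : Type*} [MetricSpace α]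
    [SecondCountableTopology α] [MeasurableSpace α] [BorelSpace α] (ν : Measure α)
    [IsProbabilityMeasure ν] {ε : ℝ}
    (hε : 0 < ε) : ∃ U : ℕ → Set α, (∀ n, MeasurableSet (U n)) ∧
      Pairwise (Function.onFun Disjoint U) ∧ ⋃ n, U n = univ ∧
      (∀ n, ∀ x ∈ U n, ∀ y ∈ U n, dist x y ≤ ε) ∧ ∀ n, ν (frontier (U n)) = 0 := by
  have : Nonempty α := ν.nonempty_of_neZero
  have h : ∀ n, ∃ r ∈ Ioo (ε / 4) (ε / 2),
      ν (frontier (Metric.thickening r {TopologicalSpace.denseSeq α n})) = 0 := fun n =>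
    exists_null_frontier_thickening ν _ (by linarith)
  choose r hr hν using h
  simp only [Metric.thickening_singleton] at hν
  set B : ℕ → Set α := fun n => Metric.ball (TopologicalSpace.denseSeq α n) (r n) with hB
  refine ⟨disjointed B, fun n => .disjointed (fun n => measurableSet_ball) n, disjoint_disjointed B,
    ?_, fun n x hx y hy => ?_, fun n => ?_⟩
  · rw [iUnion_disjointed, eq_univ_iff_forall]
    intro x
    obtain ⟨n, hn⟩ := (TopologicalSpace.denseRange_denseSeq α).exists_dist_lt x
      (show 0 < ε / 4 by linarith)
    exact mem_iUnion.2 ⟨n, Metric.mem_ball.2 (hn.trans (hr n).1)⟩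
  · have hx' := Metric.mem_ball.1 (disjointed_subset B n hx)
    have hy' := Metric.mem_ball.1 (disjointed_subset B n hy)
    have := dist_triangle_right x y (TopologicalSpace.denseSeq α n)
    linarith [(hr n).2]
  · refine disjointedRec (p := fun s => ν (frontier s) = 0) (fun {t i} ht => ?_) (hν n)
    rw [sdiff_eq]
    exact null_frontier_inter ht (by rw [frontier_compl]; exact hν i)

/-- Weak convergence of measures implies convergence of the associated mm-spaces in the box
distance. -/
theorem eventually_box_ofMeasure_le {ι : Type*} {L : Filter ι} {νs : ι → ProbabilityMeasure α}
    {ν : ProbabilityMeasure α} (h : Tendsto νs L (𝓝 ν)) {ε : ℝ≥0} (hε : 0 < ε) :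
    ∀ᶠ i in L, (ofMeasure (ν : Measure α)).box (ofMeasure (νs i : Measure α)) ≤ ε := by
  obtain ⟨U, hUm, hUd, hUu, hUdist, hUν⟩ := exists_partition_null_frontier (ν : Measure α)
    (show 0 < (ε : ℝ) / 2 by positivity)
  have hsum : ∑' n, (ν : Measure α) (U n) = 1 := by
    rw [← measure_iUnion hUd hUm, hUu, measure_univ]
  have hlt : 1 - (ε : ℝ≥0∞) < 1 :=
    ENNReal.sub_lt_self ENNReal.one_ne_top one_ne_zero (by exact_mod_cast hε.ne')
  have h1 := (ENNReal.summable (f := fun n => (ν : Measure α) (U n))).hasSum.tendsto_sum_nat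
  rw [hsum] at h1
  obtain ⟨k, hk⟩ := (h1.eventually (lt_mem_nhds hlt)).exists
  have h2 : Tendsto (fun i => ∑ n ∈ Finset.range k,
      min ((ν : Measure α) (U n)) ((νs i : Measure α) (U n))) L
      (𝓝 (∑ n ∈ Finset.range k, (ν : Measure α) (U n))) := by
    refine tendsto_finsetSum _ fun n _ => ?_
    have := (tendsto_const_nhds (x := (ν : Measure α) (U n))).min
      (ProbabilityMeasure.tendsto_measure_of_null_frontier_of_tendsto' h (hUν n))
    rwa [min_self] at this
  filter_upwards [h2.eventually (lt_mem_nhds hk)] with i hi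
  refine box_le_of_cells (A := fun n => ofMeasureVal (ν : Measure α) ⁻¹' U n)
    (B := fun n => ofMeasureVal (νs i : Measure α) ⁻¹' U n)
    (fun n => measurable_ofMeasureVal _ (hUm n)) (fun n => measurable_ofMeasureVal _ (hUm n))
    (fun a b hab => (hUd hab).preimage _) (fun a b hab => (hUd hab).preimage _) ?_ ?_
  · intro a b x hx y hy x' hx' y' hy'
    have e1 := hUdist a _ hx _ hy
    have e2 := hUdist b _ hx' _ hy'
    have e3 := dist_dist_dist_le (ofMeasureVal (ν : Measure α) x) (ofMeasureVal _ x')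
      (ofMeasureVal (νs i : Measure α) y) (ofMeasureVal _ y')
    rw [Real.dist_eq, (isometry_ofMeasureVal _).dist_eq, (isometry_ofMeasureVal _).dist_eq] at e3
    linarith
  · simp_rw [ofMeasure_μ_preimage]
    exact hi.le.trans (ENNReal.sum_le_tsum _)

end OfMeasure

end MMSpace

/-! ### Separation distances and the number of points of limit spaces -/

theorem pyramidSep_le {P : Set MMSpace} {N : ℕ} (κ : Fin (N + 1) → ℝ) {δ : ℝ} (hδ : 0 < δ) :
    pyramidSep P κ ≤ ⨆ X ∈ P, X.sep (fun i => κ i - δ) := by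
  refine le_of_tendsto (tendsto_pyramidSep P κ) ?_
  filter_upwards [Ioo_mem_nhdsGT hδ] with a ha
  refine iSup₂_mono fun X _ => iSup_mono fun A => iSup_mono' fun hA => ⟨fun i => ?_, le_rfl⟩
  exact ⟨(hA i).1, (ENNReal.ofReal_le_ofReal (by linarith [ha.2])).trans (hA i).2⟩

/-- Passing from `κ` to `κ - δ` only increases the separation distance. -/
theorem MMSpace.sep_le_pyramidSep {P : Set MMSpace} {X : MMSpace} (hX : X ∈ P) {N : ℕ}
    (κ : Fin (N + 1) → ℝ) : X.sep κ ≤ pyramidSep P κ := by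
  refine ge_of_tendsto (tendsto_pyramidSep P κ) ?_
  filter_upwards [self_mem_nhdsWithin] with a ha
  refine le_trans ?_ (le_iSup₂ X hX)
  refine iSup_mono fun A => iSup_mono' fun hA => ⟨fun i => ?_, le_rfl⟩
  exact ⟨(hA i).1, (ENNReal.ofReal_le_ofReal (by linarith [mem_Ioi.1 ha])).trans (hA i).2⟩

/-- A limit point of spaces in the pyramids belongs to the weak limit. -/
theorem WeakConverges.mem_of_frequently {P : ℕ → Set MMSpace} {Q : Set MMSpace}
    (hPQ : WeakConverges P Q) {X : MMSpace}
    (h : ∀ ε : ℝ≥0, 0 < ε → ∃ᶠ n in atTop, X.boxInf (P n) ≤ ε) : X ∈ Q := by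
  by_contra hX
  obtain ⟨ε, hε, hlt⟩ := ENNReal.lt_iff_exists_nnreal_btwn.1 (hPQ.2 X hX)
  obtain ⟨n, hn, hn'⟩ := ((h ε (by exact_mod_cast hε)).and_eventually
    (eventually_lt_of_lt_liminf hlt)).exists
  exact hn.not_gt hn'

/-- The point of the cube `[0, r]^(N+1)` with `i`-th coordinate `0` and all the others `r`. -/
def cubeVertex {N : ℕ} {r : ℝ} (hr : 0 ≤ r) (i : Fin (N + 1)) : Fin (N + 1) → Icc (0 : ℝ) r :=
  fun j => if j = i then ⟨0, le_rfl, hr⟩ else ⟨r, hr, le_rfl⟩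

theorem cubeVertex_injective {N : ℕ} {r : ℝ} (hr : 0 < r) :
    Function.Injective (cubeVertex (N := N) hr.le) := by
  intro i j hij
  by_contra hne
  have h := congrArg Subtype.val (congrFun hij i)
  simp [cubeVertex, hne] at h
  exact hr.ne h

/-- Truncated distances to `r`-separated sets define a `1`-Lipschitz map to the cube `[0, r]^(N+1)`
that collapses each of these sets to a vertex. -/
theorem exists_lipschitz_to_cube {α : Type*} [PseudoMetricSpace α] {N : ℕ} {r : ℝ} (hr : 0 ≤ r)
    {A : Fin (N + 1) → Set α} (hA : ∀ i, (A i).Nonempty)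
    (hsep : ∀ i j, i ≠ j → ∀ x ∈ A i, ∀ y ∈ A j, r ≤ dist x y) :
    ∃ f : α → Fin (N + 1) → Icc (0 : ℝ) r, LipschitzWith 1 f ∧
      ∀ i, ∀ x ∈ A i, f x = cubeVertex hr i := by
  refine ⟨fun x i => ⟨min (Metric.infDist x (A i)) r, le_min Metric.infDist_nonneg hr,
    min_le_right _ _⟩, fun x y => ?_, fun i x hx => ?_⟩
  · rw [edist_pi_le_iff]
    exact fun i => (Metric.lipschitz_infDist_pt (A i)).min_const r x y
  · funext j
    by_cases hji : j = i
    · subst hji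
      simp [cubeVertex, Metric.infDist_zero_of_mem hx, hr]
    · have : r ≤ Metric.infDist x (A j) :=
        (Metric.le_infDist (hA j)).2 fun {y} hy => hsep i j (Ne.symm hji) x hx y hy
      simp [cubeVertex, hji, this]

/-- If the separation distances do not tend to `0`, then the weak limit contains a space with more
than `N` points. -/
theorem exists_injective_of_not_isNLevy {N : ℕ} {P : ℕ → Set MMSpace} {Q : Set MMSpace}
    (hP : ∀ n, IsPyramid (P n)) (hPQ : WeakConverges P Q) (hN : ¬ IsNLevy N P) :
    ∃ Y ∈ Q, ∃ p : Fin (N + 1) → Y.carrier, Function.Injective p := by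
  simp only [IsNLevy, not_forall] at hN
  obtain ⟨κ, hκ, -, hlim⟩ := hN
  rw [ENNReal.tendsto_nhds_zero] at hlim
  push Not at hlim
  obtain ⟨η, hη, hfreq⟩ := hlim
  obtain ⟨r, hr, hrη⟩ := ENNReal.lt_iff_exists_nnreal_btwn.1 hη
  replace hr : 0 < (r : ℝ) := by exact_mod_cast hr
  obtain ⟨i₀, hi₀⟩ := Finite.exists_min κ
  set δ := κ i₀ / 2 with hδ
  have hδ0 : 0 < δ := half_pos (hκ i₀)
  let K := Fin (N + 1) → Icc (0 : ℝ) r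
  -- images in the cube of widely separated spaces
  have hex : ∀ n, ∃ ν : ProbabilityMeasure K, η < pyramidSep (P n) κ →
      MMSpace.ofMeasure (ν : Measure K) ∈ P n ∧
        ∀ i, ENNReal.ofReal δ ≤ (ν : Measure K) {cubeVertex hr.le i} := by
    intro n
    by_cases hn : η < pyramidSep (P n) κ
    · have h := (hrη.trans hn).trans_le (pyramidSep_le κ hδ0)
      simp only [MMSpace.sep, lt_iSup_iff] at h
      obtain ⟨X, hX, A, hA, hlt⟩ := h
      have hAδ : ∀ i, ENNReal.ofReal δ ≤ X.μ (A i) := fun i =>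
        (ENNReal.ofReal_le_ofReal (by linarith [hi₀ i])).trans (hA i).2
      have hne : ∀ i, (A i).Nonempty := fun i => nonempty_of_measure_ne_zero (μ := X.μ)
        ((ENNReal.ofReal_pos.2 hδ0).trans_le (hAδ i)).ne'
      have hsep : ∀ i j, i ≠ j → ∀ x ∈ A i, ∀ y ∈ A j, (r : ℝ) ≤ dist x y := by
        intro i j hij x hx y hy
        have h1 : (r : ℝ≥0∞) ≤ edist x y := by
          refine hlt.le.trans ?_
          refine (iInf_le _ i).trans <| (iInf_le _ j).trans <| (iInf_le _ hij).trans ?_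
          exact (iInf₂_le x hx).trans (iInf₂_le y hy)
        rw [edist_nndist] at h1
        exact_mod_cast h1
      obtain ⟨f, hf, hfA⟩ := exists_lipschitz_to_cube hr.le hne hsep
      have hfm : Measurable f := hf.continuous.measurable
      have hprob : IsProbabilityMeasure (X.μ.map f) :=
        Measure.isProbabilityMeasure_map hfm.aemeasurable
      refine ⟨⟨X.μ.map f, hprob⟩, fun _ => ⟨?_, fun i => ?_⟩⟩
      · exact (hP n).mem_of_prec X hX _ (MMSpace.ofMeasure_map_prec X hf)
      · change _ ≤ X.μ.map f _
        rw [Measure.map_apply hfm (measurableSet_singleton _)]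
        exact (hAδ i).trans (measure_mono fun x hx => hfA i x hx)
    · exact ⟨⟨Measure.dirac (cubeVertex hr.le 0), inferInstance⟩, fun h => absurd h hn⟩
  choose νs hνs using hex
  have hF : (atTop ⊓ 𝓟 {n | η < pyramidSep (P n) κ}).NeBot := frequently_mem_iff_neBot.1 hfreq
  -- a limit of the image measures along the spaces with large separation
  let U := Ultrafilter.of (atTop ⊓ 𝓟 {n | η < pyramidSep (P n) κ})
  have hU : (U : Filter ℕ) ≤ atTop ⊓ 𝓟 {n | η < pyramidSep (P n) κ} := Ultrafilter.of_le _
  have hUtop : (U : Filter ℕ) ≤ atTop := hU.trans inf_le_left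
  have hUS : ∀ᶠ n in U, η < pyramidSep (P n) κ :=
    hU.trans inf_le_right (mem_principal_self _)
  have hν : Tendsto νs U (𝓝 (U.map νs).lim) := Ultrafilter.le_nhds_lim (U.map νs)
  set ν := (U.map νs).lim
  refine ⟨MMSpace.ofMeasure (ν : Measure K), hPQ.mem_of_frequently fun ε hε => ?_, ?_⟩
  · refine Frequently.filter_mono (Eventually.frequently ?_) hUtop
    filter_upwards [hUS, MMSpace.eventually_box_ofMeasure_le hν hε] with n hn hbox
    exact (iInf₂_le _ (hνs n hn).1).trans hbox
  · have hatom : ∀ i, ENNReal.ofReal δ ≤ (ν : Measure K) {cubeVertex hr.le i} := fun i => by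
      refine le_trans ?_
        (ProbabilityMeasure.limsup_measure_closed_le_of_tendsto hν isClosed_singleton)
      refine le_limsup_of_frequently_le (Eventually.frequently ?_)
      exact hUS.mono fun n hn => (hνs n hn).2 i
    refine ⟨fun i => ⟨cubeVertex hr.le i, ?_⟩, fun i j hij => ?_⟩
    · refine (Measure.mem_support_iff_forall _).2 fun V hV => ?_
      exact ((ENNReal.ofReal_pos.2 hδ0).trans_le (hatom i)).trans_le
        (measure_mono (singleton_subset_iff.2 (mem_of_mem_nhds hV)))
    · exact cubeVertex_injective hr (congrArg (MMSpace.ofMeasureVal (ν : Measure K)) hij)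

/-- A space with more than `N` points in the weak limit keeps the separation distances away
from `0`. -/
theorem not_isNLevy_of_injective {N : ℕ} {P : ℕ → Set MMSpace} {Q : Set MMSpace}
    (hPQ : WeakConverges P Q) {Y : MMSpace} (hY : Y ∈ Q) {p : Fin (N + 1) → Y.carrier}
    (hp : Function.Injective p) : ¬ IsNLevy N P := by
  intro hL
  -- a lower bound `4 * r` for the distances of the chosen points
  obtain ⟨r, hr, hrdist⟩ : ∃ r : ℝ, 0 < r ∧ ∀ i j, i ≠ j → 4 * r ≤ dist (p i) (p j) := by
    obtain ⟨r, hr, h⟩ := ENNReal.lt_iff_exists_nnreal_btwn.1 (finite_range p).einfsep_pos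
    refine ⟨r / 4, by have : 0 < r := by exact_mod_cast hr
                      positivity, fun i j hij => ?_⟩
    have h1 : (r : ℝ≥0∞) ≤ edist (p i) (p j) := h.le.trans
      (einfsep_le_edist_of_mem (mem_range_self i) (mem_range_self j) (hp.ne hij))
    rw [edist_nndist] at h1
    have h2 : (r : ℝ) ≤ dist (p i) (p j) := by exact_mod_cast h1
    linarith
  -- a common lower bound for the masses of the balls around them
  obtain ⟨κ, hκ, hκN, hκμ⟩ : ∃ κ : ℝ, 0 < κ ∧ (N + 1) * κ < 1 ∧
      ∀ i, ENNReal.ofReal (2 * κ) ≤ Y.μ (Metric.ball (p i) r) := by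
    obtain ⟨i₀, hi₀⟩ := Finite.exists_min fun i => Y.μ.real (Metric.ball (p i) r)
    have h0 : 0 < Y.μ.real (Metric.ball (p i₀) r) :=
      ENNReal.toReal_pos (Metric.measure_ball_pos Y.μ _ hr).ne' (measure_ne_top _ _)
    refine ⟨min (Y.μ.real (Metric.ball (p i₀) r) / 2) (1 / (2 * (N + 1))), by positivity, ?_,
      fun i => ?_⟩
    · calc ((N : ℝ) + 1) * min (Y.μ.real (Metric.ball (p i₀) r) / 2) (1 / (2 * (N + 1)))
          ≤ (N + 1) * (1 / (2 * (N + 1))) := by gcongr; exact min_le_right _ _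
        _ < 1 := by field_simp; norm_num
    · refine ENNReal.ofReal_le_of_le_toReal ?_
      have := min_le_left (Y.μ.real (Metric.ball (p i₀) r) / 2) (1 / (2 * ((N : ℝ) + 1)))
      have := hi₀ i
      simp only [measureReal_def] at *
      linarith
  have hsepbound : ∀ Z : MMSpace, Y.box Z < ENNReal.ofReal (min κ r) →
      ENNReal.ofReal r ≤ Z.sep (fun _ : Fin (N + 1) => κ) := by
    intro Z hZ
    simp only [MMSpace.box, iInf_lt_iff] at hZ
    obtain ⟨ε, ⟨φ, ψ, I₀, hφ, hψ, hI, hdist, hmass⟩, hε⟩ := hZ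
    have hε' : (ε : ℝ) < min κ r := by
      rwa [ENNReal.lt_ofReal_iff_toReal_lt ENNReal.coe_ne_top] at hε
    have hεκ := hε'.trans_le (min_le_left _ _)
    have hεr := hε'.trans_le (min_le_right _ _)
    -- images of Borel sets under `ψ` need not be Borel, their closures are
    let A : Fin (N + 1) → Set Z.carrier :=
      fun i => closure (ψ '' (φ ⁻¹' Metric.ball (p i) r ∩ I₀))
    refine le_trans ?_ (le_iSup₂ (f := fun (A : Fin (N + 1) → Set Z.carrier) (_ : ∀ i,
      MeasurableSet (A i) ∧ ENNReal.ofReal κ ≤ Z.μ (A i)) =>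
      ⨅ (i : Fin (N + 1)) (j : Fin (N + 1)) (_ : i ≠ j), ⨅ x ∈ A i, ⨅ y ∈ A j, edist x y) A ?_)
    · refine le_iInf fun i => le_iInf fun j => le_iInf fun hij => le_iInf₂ fun x hx =>
        le_iInf₂ fun y hy => ?_
      rw [edist_dist]
      refine ENNReal.ofReal_le_ofReal ?_
      have hcl := map_mem_closure₂ (u := Ici r) continuous_dist hx hy ?_
      · rwa [isClosed_Ici.closure_eq] at hcl
      rintro _ ⟨s, ⟨hs, hsI⟩, rfl⟩ _ ⟨t, ⟨ht, htI⟩, rfl⟩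
      have h1 := (abs_le.1 (hdist s hsI t htI)).2
      have h2 := hrdist i j hij
      have h3 := Metric.mem_ball'.1 hs
      have h4 := Metric.mem_ball.1 ht
      have h5 := dist_triangle4 (p i) (φ s) (φ t) (p j)
      simp only [mem_Ici]
      linarith
    · intro i
      refine ⟨isClosed_closure.measurableSet, ?_⟩
      have : IsProbabilityMeasure MMSpace.leb := by
        have h := Y.prob
        rw [← hφ.2] at h
        exact Measure.isProbabilityMeasure_of_map φ
      have hcompl : MMSpace.leb I₀ᶜ ≤ ENNReal.ofReal κ := by
        rw [prob_compl_eq_one_sub hI]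
        refine (tsub_le_iff_tsub_le.1 hmass).trans ?_
        rw [← ENNReal.ofReal_coe_nnreal]
        exact ENNReal.ofReal_le_ofReal hεκ.le
      have hball := hκμ i
      rw [← hφ.2, Measure.map_apply hφ.1 measurableSet_ball, two_mul,
        ENNReal.ofReal_add hκ.le hκ.le] at hball
      rw [← hψ.2, Measure.map_apply hψ.1 isClosed_closure.measurableSet]
      refine (ENNReal.add_le_add_iff_right ENNReal.ofReal_ne_top).1 <|
        hball.trans <| (measure_le_inter_add_sdiff _ _ I₀).trans (add_le_add ?_ ?_)
      · exact measure_mono fun s hs => subset_closure (mem_image_of_mem ψ hs)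
      · exact (measure_mono fun s hs => hs.2).trans hcompl
  have h := hL (fun _ => κ) (fun _ => hκ) (by simpa using hκN)
  have h1 := h.eventually (gt_mem_nhds (ENNReal.ofReal_pos.2 hr))
  have h2 := (hPQ.1 Y hY).eventually (gt_mem_nhds (ENNReal.ofReal_pos.2 (lt_min hκ hr)))
  obtain ⟨n, hn1, hn2⟩ := (h1.and h2).exists
  simp only [MMSpace.boxInf, iInf_lt_iff] at hn2
  obtain ⟨Z, hZ, hbox⟩ := hn2
  exact hn1.not_ge ((hsepbound Z hbox).trans (MMSpace.sep_le_pyramidSep hZ _))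

/-! ### Pyramids of spaces with boundedly many points -/

/-- As `ν` has full support, a map from a finite space that pushes a measure forward to `ν` misses
no point. -/
theorem surjective_of_map_eq {α β : Type*} [Finite α] [MeasurableSpace α] [TopologicalSpace β]
    [T1Space β] [MeasurableSpace β] [OpensMeasurableSpace β] {μ : Measure α} {ν : Measure β}
    [ν.IsOpenPosMeasure] {f : α → β} (hf : Measurable f) (h : μ.map f = ν) :
    Function.Surjective f := by
  have hopen : IsOpen (range f)ᶜ := (finite_range f).isClosed.isOpen_compl
  rw [← range_eq_univ, ← compl_empty_iff, ← hopen.measure_eq_zero_iff ν, ← h,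
    Measure.map_apply hf hopen.measurableSet]
  simp

theorem borelSpace_of_finite (α : Type*) [Finite α] [TopologicalSpace α] [T1Space α]
    [MeasurableSpace α] [MeasurableSingletonClass α] : BorelSpace α :=
  ⟨by
    rw [borel_eq_top_of_discrete, eq_top_iff]
    exact fun s _ => s.toFinite.measurableSet⟩

theorem isOpenPosMeasure_of_singleton_ne_zero {α : Type*} [TopologicalSpace α] [MeasurableSpace α]
    {μ : Measure α} (h : ∀ x, μ {x} ≠ 0) : μ.IsOpenPosMeasure :=
  ⟨fun _ _ ⟨x, hx⟩ h0 => h x (measure_mono_null (singleton_subset_iff.2 hx) h0)⟩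

/-- The extended mm-space given by a metric with values in `[0, ∞]` and a measure with positive
point masses on a finite set. The σ-algebra contains all subsets, so it is the Borel one for every
metric. -/
def ExtMMSpace.ofFinite {α : Type} [Finite α] [MeasurableSpace α] [MeasurableSingletonClass α]
    (d : EMetricSpace α) (μ : Measure α) [IsProbabilityMeasure μ] (hμ : ∀ x, μ {x} ≠ 0) :
    ExtMMSpace where
  carrier := α
  emetric := d
  borel := borelSpace_of_finite α
  μ := μ
  fullSupport := isOpenPosMeasure_of_singleton_ne_zero hμ

theorem ExtMMSpace.mem_pyramid_ofFinite {α : Type} [Finite α] [MeasurableSpace α]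
    [MeasurableSingletonClass α] {d : EMetricSpace α} {μ : Measure α} [IsProbabilityMeasure μ]
    {hμ : ∀ x, μ {x} ≠ 0} {Y : MMSpace} : Y ∈ (ExtMMSpace.ofFinite d μ hμ).pyramid ↔
      ∃ g : α → Y.carrier, (∀ x y, edist (g x) (g y) ≤ d.edist x y) ∧ μ.map g = Y.μ :=
  exists_congr fun g => and_congr_left fun _ => by
    simp only [LipschitzWith, ENNReal.coe_one, one_mul]
    rfl

namespace MMSpace

theorem Prec.refl (X : MMSpace) : X.Prec X := ⟨id, LipschitzWith.id, Measure.map_id⟩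

theorem Prec.trans {X Y Z : MMSpace} (h : X.Prec Y) (h' : Y.Prec Z) : X.Prec Z := by
  obtain ⟨f, hf, hfμ⟩ := h
  obtain ⟨g, hg, hgμ⟩ := h'
  refine ⟨f ∘ g, by simpa using hf.comp hg, ?_⟩
  rw [← Measure.map_map hf.continuous.measurable hg.continuous.measurable, hgμ, hfμ]

theorem μ_singleton_ne_zero (X : MMSpace) [Finite X.carrier] (x : X.carrier) : X.μ {x} ≠ 0 :=
  (isOpen_discrete {x}).measure_ne_zero X.μ (singleton_nonempty x)

/-- A finite mm-space with its metric multiplied by `c > 0`. The points and the measure are literally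
the same. -/
def scale (X : MMSpace) [Finite X.carrier] {c : ℝ} (hc : 0 < c) : MMSpace :=
  have : MeasurableSingletonClass X.carrier := inferInstance
  let d : MetricSpace X.carrier :=
    { dist := fun x y => c * dist x y
      dist_self := fun x => by simp
      dist_comm := fun x y => by simp only [dist_comm]
      dist_triangle := fun x y z => by
        rw [← mul_add]
        exact mul_le_mul_of_nonneg_left (dist_triangle x y z) hc.le
      eq_of_dist_eq_zero := fun {x y} h => by simpa [hc.ne'] using h }
  { carrier := X.carrier
    metric := d
    complete := letI := d; inferInstance
    separable := letI := d; inferInstance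
    borel := letI := d; borelSpace_of_finite X.carrier
    μ := X.μ
    fullSupport := letI := d; isOpenPosMeasure_of_singleton_ne_zero X.μ_singleton_ne_zero }

theorem box_scale_le (X : MMSpace) [Finite X.carrier] {c : ℝ} (hc : 0 < c) {ε : ℝ≥0}
    (h : ∀ x y : X.carrier, |dist x y - c * dist x y| ≤ ε) : X.box (X.scale hc) ≤ ε := by
  have hm : Measurable fun x : X.carrier => (x, x) := measurable_id.prodMk measurable_id
  have h1 : (X.μ.map fun x => (x, x)).map Prod.fst = X.μ := by
    rw [Measure.map_map measurable_fst hm]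
    exact Measure.map_id
  have h2 : (X.μ.map fun x => (x, x)).map Prod.snd = X.μ := by
    rw [Measure.map_map measurable_snd hm]
    exact Measure.map_id
  refine box_le_of_coupling (X := X) (Y := X.scale hc) (X.μ.map fun x => (x, x)) h1 h2
    (S := range fun x : X.carrier => (x, x)) (finite_range _).measurableSet ?_ ?_
  · refine tsub_le_self.trans ?_
    refine le_trans ?_ (Measure.le_map_apply hm.aemeasurable _)
    rw [← X.prob.measure_univ]
    exact measure_mono fun x _ => mem_range_self x
  · rintro _ ⟨x, rfl⟩ _ ⟨y, rfl⟩
    exact h x y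

/-- A space that dominates `X` without having more points is, up to a measure preserving bijection,
the set `X` with a larger metric. -/
theorem Prec.exists_equiv {X Y : MMSpace} [Finite X.carrier] [Finite Y.carrier] (h : X.Prec Y)
    (hcard : Nat.card Y.carrier ≤ Nat.card X.carrier) :
    ∃ e : X.carrier ≃ Y.carrier, X.μ.map e = Y.μ ∧ ∀ x y, edist x y ≤ edist (e x) (e y) := by
  obtain ⟨f, hf, hfμ⟩ := h
  have hfm : Measurable f := hf.continuous.measurable
  have hbij : Function.Bijective f :=
    (surjective_of_map_eq hfm hfμ).bijective_of_nat_card_le hcard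
  let e := Equiv.ofBijective f hbij
  refine ⟨e.symm, ?_, fun x y => ?_⟩
  · rw [← hfμ, Measure.map_map (measurable_of_finite _) hfm]
    have : ⇑e.symm ∘ f = id := funext fun x => e.symm_apply_apply x
    rw [this, Measure.map_id]
  · have := hf (e.symm x) (e.symm y)
    rw [ENNReal.coe_one, one_mul] at this
    rwa [show f (e.symm x) = x from e.apply_symm_apply x,
      show f (e.symm y) = y from e.apply_symm_apply y] at this

end MMSpace

/-- The copies of a finite space scaled by `c < 1` approximate it in the box distance. -/
theorem IsPyramid.mem_of_forall_scale_mem {P : Set MMSpace} (hP : IsPyramid P) {X : MMSpace}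
    [Finite X.carrier] (h : ∀ (c : ℝ) (hc : 0 < c), c < 1 → X.scale hc ∈ P) : X ∈ P := by
  refine hP.box_closed X fun ε hε => ?_
  obtain ⟨ε', hε', hlt⟩ := ENNReal.lt_iff_exists_nnreal_btwn.1 hε
  replace hε' : 0 < (ε' : ℝ) := by exact_mod_cast hε'
  have hD : 0 < Metric.diam (univ : Set X.carrier) + 1 := by
    linarith [Metric.diam_nonneg (s := (univ : Set X.carrier))]
  set D := Metric.diam (univ : Set X.carrier) + 1 with hDdef
  set t := min (1 / 2) (ε' / D) with ht
  have ht0 : 0 < t := lt_min (by norm_num) (by positivity)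
  have ht1 : t ≤ 1 / 2 := min_le_left _ _
  have hc : 0 < 1 - t := by linarith
  refine ⟨X.scale hc, h _ hc (by linarith), (X.box_scale_le hc fun x y => ?_).trans_lt hlt⟩
  have hxy : dist x y ≤ D := by
    have := Metric.dist_le_diam_of_mem (toFinite univ).isBounded (mem_univ x) (mem_univ y)
    linarith
  have e : dist x y - (1 - t) * dist x y = t * dist x y := by ring
  rw [e, abs_of_nonneg (by positivity)]
  calc t * dist x y ≤ (ε' / D) * D := by
        gcongr
        exact min_le_right _ _
    _ = ε' := by field_simp

/-- A pyramid of spaces with at most `N` points is the pyramid of an extended mm-space with at most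
`N` points: on the points of a space of maximal cardinality, take the limit of the metrics of the
spaces above it. -/
theorem IsPyramid.exists_eq_pyramid {Q : Set MMSpace} (hQ : IsPyramid Q) {N : ℕ}
    (hN : ∀ Y ∈ Q, Finite Y.carrier ∧ Nat.card Y.carrier ≤ N) :
    ∃ X : ExtMMSpace, Finite X.carrier ∧ Nat.card X.carrier ≤ N ∧ Q = X.pyramid := by
  -- all spaces above `Y₀` have as many points as `Y₀`
  obtain ⟨Y₀, hY₀, hmax⟩ : ∃ Y₀ ∈ Q, ∀ Z ∈ Q, Nat.card Z.carrier ≤ Nat.card Y₀.carrier := by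
    have hne : ((fun Z : MMSpace => Nat.card Z.carrier) '' Q).Nonempty := hQ.nonempty.image _
    have hb : BddAbove ((fun Z : MMSpace => Nat.card Z.carrier) '' Q) :=
      ⟨N, by rintro _ ⟨Z, hZ, rfl⟩; exact (hN Z hZ).2⟩
    obtain ⟨Y₀, hY₀, h⟩ := Nat.sSup_mem hne hb
    exact ⟨Y₀, hY₀, fun Z hZ => (le_csSup hb ⟨Z, hZ, rfl⟩).trans_eq h.symm⟩
  have hfin₀ : Finite Y₀.carrier := (hN Y₀ hY₀).1
  -- an ultrafilter along the directed set of the spaces of `Q` above `Y₀`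
  let I := {Z : MMSpace // Z ∈ Q ∧ Y₀.Prec Z}
  let _ : Preorder I :=
    { le := fun Z W => Z.1.Prec W.1
      le_refl := fun Z => MMSpace.Prec.refl _
      le_trans := fun _ _ _ h h' => h.trans h' }
  have : Nonempty I := ⟨⟨Y₀, hY₀, .refl _⟩⟩
  have : IsDirected I (· ≤ ·) := ⟨fun Z W => by
    obtain ⟨V, hV, h1, h2⟩ := hQ.directed _ Z.2.1 _ W.2.1
    exact ⟨⟨V, hV, Z.2.2.trans h1⟩, h1, h2⟩⟩
  let U : Ultrafilter I := Ultrafilter.of atTop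
  have hU : (U : Filter I) ≤ atTop := Ultrafilter.of_le _
  have hfin : ∀ Z : I, Finite Z.1.carrier := fun Z => (hN Z.1 Z.2.1).1
  choose e heμ hedist using fun Z : I => Z.2.2.exists_equiv (hmax Z.1 Z.2.1)
  -- the limit of the metrics, with values in `[0, ∞]`
  let ρ : Y₀.carrier → Y₀.carrier → ℝ≥0∞ := fun x y =>
    (U.map fun Z => edist (e Z x) (e Z y)).lim
  have hρ : ∀ x y, Tendsto (fun Z => edist (e Z x) (e Z y)) U (𝓝 (ρ x y)) := fun x y =>
    Ultrafilter.le_nhds_lim (U.map fun Z => edist (e Z x) (e Z y))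
  let d : EMetricSpace Y₀.carrier :=
    { edist := ρ
      edist_self := fun x => tendsto_nhds_unique (hρ x x) (by simp)
      edist_comm := fun x y => tendsto_nhds_unique (hρ x y) (by
        simpa only [edist_comm] using hρ y x)
      edist_triangle := fun x y z => le_of_tendsto_of_tendsto' (hρ x z) ((hρ x y).add (hρ y z))
        fun Z => edist_triangle _ _ _
      eq_of_edist_eq_zero := fun {x y} h => by
        have h1 : edist x y ≤ ρ x y := ge_of_tendsto' (hρ x y) fun Z => hedist Z x y
        exact edist_le_zero.1 (h1.trans h.le) }
  refine ⟨ExtMMSpace.ofFinite d Y₀.μ Y₀.μ_singleton_ne_zero, hfin₀, (hN Y₀ hY₀).2, ?_⟩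
  ext Y
  rw [ExtMMSpace.mem_pyramid_ofFinite]
  constructor
  · intro hY
    have hfinY : Finite Y.carrier := (hN Y hY).1
    have hex : ∀ᶠ Z in (U : Filter I), ∃ g : Y₀.carrier → Y.carrier,
        (∀ x y, edist (g x) (g y) ≤ edist (e Z x) (e Z y)) ∧ Y₀.μ.map g = Y.μ := by
      obtain ⟨V, hV, h1, h2⟩ := hQ.directed _ hY _ hY₀
      filter_upwards [hU (mem_atTop (⟨V, hV, h2⟩ : I))] with Z hZ
      obtain ⟨f, hf, hfμ⟩ := h1.trans (show V.Prec Z.1 from hZ)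
      refine ⟨f ∘ e Z, fun x y => by simpa using hf (e Z x) (e Z y), ?_⟩
      rw [← Measure.map_map hf.continuous.measurable (measurable_of_finite _), heμ, hfμ]
    -- there are only finitely many maps, so one of them works for almost all spaces
    obtain ⟨g, hg⟩ := Ultrafilter.eventually_exists_iff.1 hex
    exact ⟨g, fun x y => ge_of_tendsto (hρ x y) (hg.mono fun Z hZ => hZ.1 x y),
      hg.exists.choose_spec.2⟩
  · rintro ⟨g, hg, hgμ⟩
    have hgm : Measurable g := measurable_of_finite g
    have hfinY : Finite Y.carrier := Finite.of_surjective g (surjective_of_map_eq hgm hgμ)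
    -- a scaled copy of `Y` satisfies strict inequalities, which pass from the limit to the spaces
    -- of `Q` themselves
    refine hQ.mem_of_forall_scale_mem fun c hc hc1 => ?_
    have hev : ∀ᶠ Z in (U : Filter I), ∀ x y,
        ENNReal.ofReal (c * dist (g x) (g y)) ≤ edist (e Z x) (e Z y) := by
      refine eventually_all.2 fun x => eventually_all.2 fun y => ?_
      by_cases hxy : g x = g y
      · simp [hxy]
      · refine ((hρ x y).eventually (lt_mem_nhds ?_)).mono fun Z hZ => hZ.le
        refine lt_of_lt_of_le ?_ (hg x y)
        rw [edist_dist]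
        have := dist_pos.2 hxy
        exact (ENNReal.ofReal_lt_ofReal_iff this).2 (mul_lt_of_lt_one_left this hc1)
    obtain ⟨Z, hZ⟩ := hev.exists
    refine hQ.mem_of_prec Z.1 Z.2.1 _ ?_
    let k : Z.1.carrier → (Y.scale hc).carrier := fun z => g ((e Z).symm z)
    have hk : LipschitzWith 1 k := fun z w => by
      have := hZ ((e Z).symm z) ((e Z).symm w)
      rw [Equiv.apply_symm_apply, Equiv.apply_symm_apply] at this
      rw [ENNReal.coe_one, one_mul, edist_dist]
      exact this
    refine ⟨k, hk, ?_⟩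
    rw [← heμ Z, Measure.map_map hk.continuous.measurable (measurable_of_finite _)]
    have : k ∘ e Z = g := funext fun x => congrArg g ((e Z).symm_apply_apply x)
    rw [this]
    exact hgμ

theorem theorem5 (N : ℕ) (hN : 1 ≤ N) (P : ℕ → Set MMSpace) (Q : Set MMSpace)
    (hP : ∀ n, IsPyramid (P n)) (hQ : IsPyramid Q) (hPQ : WeakConverges P Q) :
    IsNLevy N P ↔
      ∃ X : ExtMMSpace, Finite X.carrier ∧ Nat.card X.carrier ≤ N ∧ Q = X.pyramid := by
  constructor
  · intro hL
    refine hQ.exists_eq_pyramid fun Y hY => ?_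
    by_contra hcard
    have hp : Nonempty (Fin (N + 1) ↪ Y.carrier) := by
      rcases finite_or_infinite Y.carrier with hfin | hinf
      · have := Fintype.ofFinite Y.carrier
        refine Function.Embedding.nonempty_of_card_le ?_
        rw [Fintype.card_fin, ← Nat.card_eq_fintype_card]
        by_contra! hlt
        exact hcard ⟨hfin, Nat.lt_succ_iff.1 hlt⟩
      · exact ⟨Fin.valEmbedding.trans (Infinite.natEmbedding _)⟩
    exact not_isNLevy_of_injective hPQ hY hp.some.injective hL
  · rintro ⟨X, hfin, hcard, rfl⟩
    by_contra hL
    obtain ⟨Y, ⟨g, hg, hgμ⟩, p, hp⟩ := exists_injective_of_not_isNLevy hP hPQ hL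
    have hsurj := surjective_of_map_eq hg.continuous.measurable hgμ
    have hfinY : Finite Y.carrier := Finite.of_surjective g hsurj
    have h1 := Nat.card_le_card_of_injective p hp
    have h2 := Nat.card_le_card_of_surjective g hsurj
    rw [Nat.card_eq_fintype_card, Fintype.card_fin] at h1
    omega
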